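/- Let $m\ge 1$ and let $H^m$ be the Heisenberg group, with underlying manifold $\mathbb{R}^{2m+1}\ni q=(x,y,t)$, $x,y\in\mathbb{R}^m$, $t\in\mathbb{R}$, and left-invariant vector fields $X_j=\partial_{x_j}+2y_j\partial_t$, $Y_j=\partial_{y_j}-2x_j\partial_t$ ($1\le j\le m$). For $C^1$ functions $u,v$ on $H^m$ put $\nabla_{H^m}u\cdot\nabla_{H^m}v=\sum_{j=1}^m (X_ju\,X_jv+Y_ju\,Y_jv)$ and $|\nabla_{H^m}u|=(\nabla_{H^m}u\cdot\nabla_{H^m}u)^{1/2}$. Let $\varphi,f,l:[0,\infty)\to\mathbb{R}$ and constants $D,\Lambda>0$, $\tau\ge 0$ be such that: ($\Phi$) $\varphi\in C^0([0,\infty))\cap C^1((0,\infty))$, $\varphi(0)=0$, and $\varphi'>0$ on $(0,\infty)$; ($F$) $f\in C^0([0,\infty))$, $f>0$ on $(0,\infty)$, and $f$ is non-decreasing on $[0,\infty)$; ($L$) $l\in C^0([0,\infty))$, $l>0$ on $(0,\infty)$, and for some $C\ge 1$, $\sup_{s\in[0,t]}l(s)\le C\,l(t)$ for all $t\ge 0$;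 ($\Phi$ & $L$) $t\varphi'(t)/l(t)$ is integrable near $0^+$ but not integrable near $+\infty$, and $\varphi(t)/l(t)\to 0$ as $t\to 0^+$; ($\Phi 2$) $s\,\varphi'(st)\le D s^{\tau}\varphi'(t)$ for all $s\in(0,1]$, $t>0$; ($L2$) $s^{1+\tau}l(t)\le \Lambda\, l(st)$ for all $s\in[0,1]$, $t\ge 0$. Let $u\in C^1(H^m)$ be a non-negative bounded weak solution of $$\Delta^\varphi_{H^m}u\ \ge\ f(u)\,l(|\nabla_{H^m}u|)\qquad\text{on } H^m,$$ where $\Delta^\varphi_{H^m}u=\sum_{j=1}^m\left[X_j\!\left(\frac{\varphi(|\nabla_{H^m}u|)}{|\nabla_{H^m}u|}X_ju\right)+Y_j\!\left(\frac{\varphi(|\nabla_{H^m}u|)}{|\nabla_{H^m}u|}Y_ju\right)\right]$; that is, for every $\zeta\in C_c^\infty(H^m)$ with $\zeta\ge 0$, $$-\int_{\mathbb{R}^{2m+1}}\frac{\varphi(|\nabla_{H^m}u|)}{|\nabla_{H^m}u|}\,\nabla_{H^m}u\cdot\nabla_{H^m}\zeta\ \ge\ \int_{\mathbb{R}^{2m+1}}f(u)\,l(|\nabla_{H^m}u|)\,\zeta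 ,$$ the first integrand being $0$ where $\nabla_{H^m}u=0$. Then $u$ is constant. Moreover, if $l(0)>0$, then $u\equiv 0$. -/

import Mathlib

open Filter Topology Set MeasureTheory
open scoped ContDiff

noncomputable section

/-- The underlying manifold `ℝ^(2m+1)` of the Heisenberg group `H^m`; a point is
`q = (x, y, t)` with `x, y ∈ ℝ^m` and `t ∈ ℝ`. Its `volume` is Lebesgue measure. -/
abbrev Heis (m : ℕ) : Type := (Fin m → ℝ) × (Fin m → ℝ) × ℝ

namespace Heis

variable {m : ℕ}

/-- The left-invariant vector field `X_j = ∂/∂x_j + 2 y_j ∂/∂t`, applied to `u` at `q`. -/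
def X (j : Fin m) (u : Heis m → ℝ) (q : Heis m) : ℝ :=
  fderiv ℝ u q (Pi.single j 1, 0, 2 * q.2.1 j)

/-- The left-invariant vector field `Y_j = ∂/∂y_j - 2 x_j ∂/∂t`, applied to `u` at `q`. -/
def Y (j : Fin m) (u : Heis m → ℝ) (q : Heis m) : ℝ :=
  fderiv ℝ u q (0, Pi.single j 1, -2 * q.1 j)

/-- The product `∇_H u · ∇_H v` of two horizontal gradients
`∇_H u = ∑ j, (X_j u) X_j + (Y_j u) Y_j`. -/
def gradDot (u v : Heis m → ℝ) (q : Heis m) : ℝ :=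
  ∑ j : Fin m, (X j u q * X j v q + Y j u q * Y j v q)

/-- The length `|∇_H u|` of the horizontal gradient. -/
def gradNorm (u : Heis m → ℝ) (q : Heis m) : ℝ :=
  Real.sqrt (gradDot u u q)

/-- `u` is an entire weak classical solution on `H^m` of the differential inequality
`Δ^φ u ≥ f(u) l(|∇_H u|)`: it is of class `C^1` and, for every non-negative smooth compactly
supported `ζ`,
`- ∫ |∇_H u|⁻¹ φ(|∇_H u|) ∇_H u · ∇_H ζ ≥ ∫ f(u) l(|∇_H u|) ζ`.
At points where `∇_H u = 0` the first integrand is `0`. -/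
def IsWeakSolution (φ f l : ℝ → ℝ) (u : Heis m → ℝ) : Prop :=
  ContDiff ℝ 1 u ∧
    ∀ ζ : Heis m → ℝ, ContDiff ℝ ∞ ζ → HasCompactSupport ζ → (∀ q, 0 ≤ ζ q) →
      -∫ q, (gradNorm u q)⁻¹ * φ (gradNorm u q) * gradDot u ζ q
        ≥ ∫ q, f (u q) * l (gradNorm u q) * ζ q

end Heis

/-- Condition (Φ): `φ ∈ C^0([0,∞)) ∩ C^1((0,∞))`, `φ(0) = 0`, `φ' > 0` on `(0,∞)`. -/
structure CondPhi (φ : ℝ → ℝ) : Prop where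
  continuousOn : ContinuousOn φ (Ici 0)
  contDiffOn : ContDiffOn ℝ 1 φ (Ioi 0)
  map_zero : φ 0 = 0
  deriv_pos : ∀ t, 0 < t → 0 < deriv φ t

/-- Condition (F): `f ∈ C^0([0,∞))`, `f > 0` on `(0,∞)`, `f` increasing (in the wide sense)
on `[0,∞)`. -/
structure CondF (f : ℝ → ℝ) : Prop where
  continuousOn : ContinuousOn f (Ici 0)
  pos : ∀ t, 0 < t → 0 < f t
  monotoneOn : MonotoneOn f (Ici 0)

/-- Condition (L): `l ∈ C^0([0,∞))`, `l > 0` on `(0,∞)`, and `l` is `C`-monotone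
non-decreasing on `[0,∞)` for some `C ≥ 1`: `sup_{[0,t]} l ≤ C l(t)` for all `t ≥ 0`. -/
structure CondL (l : ℝ → ℝ) : Prop where
  continuousOn : ContinuousOn l (Ici 0)
  pos : ∀ t, 0 < t → 0 < l t
  cMonotone : ∃ C : ℝ, 1 ≤ C ∧ ∀ t, 0 ≤ t → ∀ s ∈ Icc 0 t, l s ≤ C * l t

/-- Condition (Φ & L): `t φ'(t) / l(t) ∈ L^1(0+) \ L^1(+∞)` and `φ(t)/l(t) = o(1)` as
`t → 0+`. -/
structure CondPhiL (φ l : ℝ → ℝ) : Prop where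
  integrable_zero : IntegrableAtFilter (fun t => t * deriv φ t / l t) (𝓝[>] 0)
  not_integrable_top : ¬ IntegrableAtFilter (fun t => t * deriv φ t / l t) atTop
  tendsto_zero : Tendsto (fun t => φ t / l t) (𝓝[>] 0) (𝓝 0)

/-- Condition (Φ2): `s φ'(st) ≤ D s^τ φ'(t)` for `s ∈ (0,1]` and `t > 0`. -/
def CondPhi2 (φ : ℝ → ℝ) (D τ : ℝ) : Prop :=
  ∀ s ∈ Ioc (0 : ℝ) 1, ∀ t, 0 < t → s * deriv φ (s * t) ≤ D * s ^ τ * deriv φ t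

/-- Condition (L2): `s^(1+τ) l(t) ≤ Λ l(st)` for `s ∈ [0,1]` and `t ≥ 0`. -/
def CondL2 (l : ℝ → ℝ) (Λ τ : ℝ) : Prop :=
  ∀ s ∈ Icc (0 : ℝ) 1, ∀ t, 0 ≤ t → s ^ (1 + τ) * l t ≤ Λ * l (s * t)

end

/-! Suppose `u q₀ < c < u q₁`, and compare `u` with `ε` times the Korányi gauge centred at a point
of the open set `O = {u < c}`. As `u` is bounded and the gauge tends to infinity, the difference has
a global maximum; if its value exceeds `c`, it is attained outside `O`, at gauge distance at least
some `r > 0`. There the horizontal gradient of the barrier has length `p ≤ ε`, and the operator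
applied to the barrier is at most `φ(p) (2m+1) / r` (`hdiv_radialFlux_gauge`). A weak solution
satisfies the inequality pointwise where a `C²` function with nonzero horizontal gradient touches it
from above (`touching`), so `f(c) l(p) ≤ φ(p) (2m+1) / r`. This contradicts `φ/l → 0` for small `ε`.
Hence `u q₁ ≤ c + ε · gauge`, and `ε → 0` gives `u q₁ ≤ c`, absurd.

The obstacle is that the gauge has zero horizontal gradient on the vertical axis through its centre,
where `touching` says nothing. Three centres in `O` are therefore used at once (`exists_staircase`):
on each axis, outside `O`, another centre is strictly closer, so the largest of the three maxima
cannot be attained on its own axis. -/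

instance heis_isAddHaarMeasure (m : ℕ) : (volume : Measure (Heis m)).IsAddHaarMeasure := by
  have h : (volume : Measure ((Fin m → ℝ) × ℝ)).IsAddHaarMeasure :=
    Measure.prod.instIsAddHaarMeasure _ _
  exact Measure.prod.instIsAddHaarMeasure _ _

/-! ### From smooth to `C^1` test functions -/

section Mollification

variable {E : Type*} [NormedAddCommGroup E] [NormedSpace ℝ E] [FiniteDimensional ℝ E]
  [MeasurableSpace E] [BorelSpace E]

/-- A non-negative compactly supported `C^1` function is a `C^1`-limit of non-negative test
functions supported near its support. -/
theorem exists_smooth_approx (μ : Measure E) [μ.IsAddHaarMeasure] {ζ : E → ℝ} (hζ : ContDiff ℝ 1 ζ) (hc : HasCompactSupport ζ)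
    (h0 : ∀ q, 0 ≤ ζ q) {ε : ℝ} (hε : 0 < ε) :
    ∃ η : E → ℝ, ContDiff ℝ ∞ η ∧ (∀ q, 0 ≤ η q) ∧
      tsupport η ⊆ Metric.cthickening 1 (tsupport ζ) ∧
      (∀ q, |η q - ζ q| ≤ ε) ∧ ∀ q, ‖fderiv ℝ η q - fderiv ℝ ζ q‖ ≤ ε := by
  have hd : Continuous (fderiv ℝ ζ) := hζ.continuous_fderiv one_ne_zero
  have u1 := hc.uniformContinuous_of_continuous hζ.continuous
  have u2 := (hc.fderiv (𝕜 := ℝ)).uniformContinuous_of_continuous hd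
  obtain ⟨δ1, hδ1, H1⟩ := Metric.uniformContinuous_iff.1 u1 ε hε
  obtain ⟨δ2, hδ2, H2⟩ := Metric.uniformContinuous_iff.1 u2 ε hε
  -- The bounds `δ1`, `δ2` control the oscillation of `ζ` and of its derivative; the bound 1 keeps
  -- the support in the 1-thickening.
  set δ := min 1 (min δ1 δ2) with hδdef
  have hδ : 0 < δ := by positivity
  let b : ContDiffBump (0 : E) := ⟨δ / 2, δ, by linarith, by linarith⟩
  have hbc := b.hasCompactSupport_normed (μ := μ)
  have hint : LocallyIntegrable (b.normed μ) μ := b.continuous_normed.locallyIntegrable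
  set η := convolution (b.normed μ) ζ (ContinuousLinearMap.lsmul ℝ ℝ) μ with hη
  have hder : ∀ q, fderiv ℝ η q
      = convolution (b.normed μ) (fderiv ℝ ζ) (ContinuousLinearMap.lsmul ℝ ℝ) μ q := by
    intro q
    rw [(hc.hasFDerivAt_convolution_right (ContinuousLinearMap.lsmul ℝ ℝ) hint hζ q).fderiv]
    rfl
  refine ⟨η, ?_, ?_, ?_, ?_, ?_⟩
  · exact hbc.contDiff_convolution_left _ b.contDiff_normed hζ.continuous.locallyIntegrable
  · intro q
    refine integral_nonneg fun x => ?_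
    exact mul_nonneg (b.nonneg_normed x) (h0 _)
  · refine closure_minimal ?_ Metric.isClosed_cthickening
    refine (support_convolution_subset _).trans ?_
    rw [b.support_normed_eq]
    rintro _ ⟨x, hx, y, hy, rfl⟩
    refine Metric.mem_cthickening_of_dist_le _ y _ _ (subset_tsupport _ hy) ?_
    have : ‖x‖ < δ := by simpa using hx
    have h1 : δ ≤ 1 := min_le_left _ _
    simp only [dist_eq_norm, add_sub_cancel_right]
    linarith
  · intro q
    have := b.dist_normed_convolution_le (μ := μ) (g := ζ) (x₀ := q) (ε := ε)
      hζ.continuous.aestronglyMeasurable (fun x hx => (H1 (lt_of_lt_of_le hx ?_)).le)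
    · simpa [Real.dist_eq] using this
    · exact (min_le_right _ _).trans (min_le_left _ _)
  · intro q
    have := b.dist_normed_convolution_le (μ := μ) (g := fderiv ℝ ζ) (x₀ := q) (ε := ε)
      hd.aestronglyMeasurable (fun x hx => (H2 (lt_of_lt_of_le hx ?_)).le)
    · rw [hder, ← dist_eq_norm]; exact this
    · exact (min_le_right _ _).trans (min_le_right _ _)

/-- A first-order distributional inequality with continuous coefficients extends from smooth to
`C^1` test functions. -/
theorem integral_nonpos_of_smooth_test (μ : Measure E) [μ.IsAddHaarMeasure] {b : E → ℝ} {V : E → E} (hb : Continuous b)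
    (hV : Continuous V)
    (h : ∀ ζ : E → ℝ, ContDiff ℝ ∞ ζ → HasCompactSupport ζ → (∀ q, 0 ≤ ζ q) →
      ∫ q, (b q * ζ q + fderiv ℝ ζ q (V q)) ∂μ ≤ 0)
    {ζ : E → ℝ} (hζ : ContDiff ℝ 1 ζ) (hc : HasCompactSupport ζ) (h0 : ∀ q, 0 ≤ ζ q) :
    ∫ q, (b q * ζ q + fderiv ℝ ζ q (V q)) ∂μ ≤ 0 := by
  set K := Metric.cthickening 1 (tsupport ζ) with hK
  have hKc : IsCompact K := hc.isCompact.cthickening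
  -- `G` does not depend on `ε`: every approximant is supported in the same compact `K`, so `ε * G`
  -- dominates the error in the integrand.
  set G : E → ℝ := K.indicator (fun q => |b q| + ‖V q‖) with hG
  have hGi : Integrable G μ :=
    ((hb.abs.add hV.norm).continuousOn.integrableOn_compact hKc).integrable_indicator
      hKc.measurableSet
  have key : ∀ ε > 0, ∫ q, (b q * ζ q + fderiv ℝ ζ q (V q)) ∂μ ≤ ε * ∫ q, G q ∂μ := by
    intro ε hε
    obtain ⟨η, hη, hη0, hηs, hη1, hη2⟩ := exists_smooth_approx μ hζ hc h0 hε
    have hηc : HasCompactSupport η := hKc.of_isClosed_subset (isClosed_tsupport _) hηs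
    have int : ∀ {ξ : E → ℝ}, ContDiff ℝ 1 ξ → HasCompactSupport ξ →
        Integrable (fun q => b q * ξ q + fderiv ℝ ξ q (V q)) μ := by
      intro ξ hξ hξc
      refine Continuous.integrable_of_hasCompactSupport ?_ ?_
      · exact (hb.mul hξ.continuous).add ((hξ.continuous_fderiv one_ne_zero).clm_apply hV)
      · refine HasCompactSupport.intro hξc.isCompact fun q hq => ?_
        have h1 : ξ q = 0 := image_eq_zero_of_notMem_tsupport hq
        have h2 : fderiv ℝ ξ q = 0 :=
          image_eq_zero_of_notMem_tsupport (fun h => hq (tsupport_fderiv_subset ℝ h))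
        simp [h1, h2]
    have hη' : ContDiff ℝ 1 η := hη.of_le (by exact_mod_cast le_top)
    have i1 := int hζ hc
    have i2 := int hη' hηc
    have hle : ∫ q, ((b q * ζ q + fderiv ℝ ζ q (V q)) - (b q * η q + fderiv ℝ η q (V q))) ∂μ
        ≤ ∫ q, ε * G q ∂μ := by
      refine integral_mono (i1.sub i2) (hGi.const_mul ε) fun q => ?_
      by_cases hq : q ∈ K
      · have e1 : b q * (ζ q - η q) ≤ |b q| * ε := by
          refine (le_abs_self _).trans ?_
          rw [abs_mul, abs_sub_comm]
          exact mul_le_mul_of_nonneg_left (hη1 q) (abs_nonneg _)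
        have e2 : (fderiv ℝ ζ q - fderiv ℝ η q) (V q) ≤ ε * ‖V q‖ := by
          refine (le_abs_self _).trans ?_
          rw [← Real.norm_eq_abs]
          refine (ContinuousLinearMap.le_opNorm _ _).trans ?_
          rw [norm_sub_rev]
          exact mul_le_mul_of_nonneg_right (hη2 q) (norm_nonneg _)
        simp only [hG, indicator_of_mem hq, sub_apply] at e2 ⊢
        linarith
      · have a1 : q ∉ tsupport ζ := fun h => hq (Metric.self_subset_cthickening _ h)
        have a2 : q ∉ tsupport η := fun h => hq (hηs h)
        have h1 : ζ q = 0 := image_eq_zero_of_notMem_tsupport a1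
        have h2 : fderiv ℝ ζ q = 0 :=
          image_eq_zero_of_notMem_tsupport (fun h => a1 (tsupport_fderiv_subset ℝ h))
        have h3 : η q = 0 := image_eq_zero_of_notMem_tsupport a2
        have h4 : fderiv ℝ η q = 0 :=
          image_eq_zero_of_notMem_tsupport (fun h => a2 (tsupport_fderiv_subset ℝ h))
        simp [h1, h2, h3, h4, hG, hq]
    rw [integral_sub i1 i2, integral_const_mul] at hle
    linarith [h η hη hηc hη0]
  have hlim : Tendsto (fun ε : ℝ => ε * ∫ q, G q ∂μ) (𝓝[>] 0) (𝓝 0) := by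
    have : Tendsto (fun ε : ℝ => ε * ∫ q, G q ∂μ) (𝓝 0) (𝓝 (0 * ∫ q, G q ∂μ)) :=
      tendsto_id.mul_const _
    rw [zero_mul] at this
    exact this.mono_left nhdsWithin_le_nhds
  exact ge_of_tendsto hlim (eventually_nhdsWithin_of_forall fun ε hε => key ε hε)

end Mollification

/-! ### Continuity, regularity and monotonicity of the flux -/

section NonlinearFlux

variable {E : Type*} [NormedAddCommGroup E] [InnerProductSpace ℝ E]

/-- The vector field `p ↦ |p|⁻¹ φ(|p|) p`. -/
noncomputable def radialFlux (φ : ℝ → ℝ) (p : E) : E := (‖p‖⁻¹ * φ ‖p‖) • p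

theorem CondPhi.strictMonoOn {φ : ℝ → ℝ} (hφ : CondPhi φ) : StrictMonoOn φ (Ici 0) :=
  strictMonoOn_of_deriv_pos (convex_Ici 0) hφ.continuousOn fun x hx => by
    rw [interior_Ici] at hx; exact hφ.deriv_pos x hx

theorem CondPhi.pos {φ : ℝ → ℝ} (hφ : CondPhi φ) {t : ℝ} (ht : 0 < t) : 0 < φ t := by
  have := hφ.strictMonoOn (self_mem_Ici) (mem_Ici.2 ht.le) ht
  rwa [hφ.map_zero] at this

theorem CondPhi.nonneg {φ : ℝ → ℝ} (hφ : CondPhi φ) {t : ℝ} (ht : 0 ≤ t) : 0 ≤ φ t := by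
  rcases ht.eq_or_lt with rfl | h
  · exact hφ.map_zero.ge
  · exact (hφ.pos h).le

theorem norm_radialFlux {φ : ℝ → ℝ} (hφ : CondPhi φ) (p : E) : ‖radialFlux φ p‖ = φ ‖p‖ := by
  rcases eq_or_ne p 0 with rfl | hp
  · simp [radialFlux, hφ.map_zero]
  · have : ‖p‖ ≠ 0 := norm_ne_zero_iff.2 hp
    rw [radialFlux, norm_smul, Real.norm_eq_abs, abs_mul, abs_inv, abs_norm,
      abs_of_nonneg (hφ.nonneg (norm_nonneg p))]
    field_simp

theorem continuous_radialFlux {φ : ℝ → ℝ} (hφ : CondPhi φ) :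
    Continuous (radialFlux φ : E → E) := by
  have hc : Continuous fun p : E => φ ‖p‖ :=
    hφ.continuousOn.comp_continuous continuous_norm fun p => norm_nonneg p
  rw [continuous_iff_continuousAt]
  intro p
  rcases eq_or_ne p 0 with rfl | hp
  · have h0 : radialFlux φ (0 : E) = 0 := by simp [radialFlux]
    rw [ContinuousAt, h0, tendsto_zero_iff_norm_tendsto_zero]
    simp_rw [norm_radialFlux hφ]
    simpa [hφ.map_zero] using hc.tendsto (0 : E)
  · exact ((continuous_norm.continuousAt.inv₀ (norm_ne_zero_iff.2 hp)).mul
      hc.continuousAt).smul continuousAt_id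

theorem contDiffAt_radialFlux {φ : ℝ → ℝ} (hφ : CondPhi φ) {p : E} (hp : p ≠ 0) :
    ContDiffAt ℝ 1 (radialFlux φ : E → E) p := by
  have hn : ContDiffAt ℝ 1 (fun p : E => ‖p‖) p := contDiffAt_norm ℝ hp
  have h1 : ContDiffAt ℝ 1 φ ‖p‖ :=
    hφ.contDiffOn.contDiffAt (Ioi_mem_nhds (norm_pos_iff.2 hp))
  exact ((hn.inv (norm_ne_zero_iff.2 hp)).mul (h1.comp p hn)).smul contDiffAt_id

/-- Cauchy–Schwarz on the mixed terms reduces the claim to `(φ a - φ b) (a - b) ≥ 0` for the norms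
`a`, `b`, which is the monotonicity of `φ`. -/
theorem radialFlux_monotone {φ : ℝ → ℝ} (hφ : CondPhi φ) (p p' : E) :
    0 ≤ inner ℝ (radialFlux φ p - radialFlux φ p') (p - p') := by
  have hself : ∀ p : E, inner ℝ (radialFlux φ p) p = φ ‖p‖ * ‖p‖ := by
    intro p
    rcases eq_or_ne p 0 with rfl | hp
    · simp
    · have : ‖p‖ ≠ 0 := norm_ne_zero_iff.2 hp
      rw [radialFlux, real_inner_smul_left, real_inner_self_eq_norm_sq]
      field_simp
  have h1 : inner ℝ (radialFlux φ p) p' ≤ φ ‖p‖ * ‖p'‖ :=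
    (real_inner_le_norm _ _).trans_eq (by rw [norm_radialFlux hφ])
  have h2 : inner ℝ (radialFlux φ p') p ≤ φ ‖p'‖ * ‖p‖ :=
    (real_inner_le_norm _ _).trans_eq (by rw [norm_radialFlux hφ])
  rw [inner_sub_left, inner_sub_right, inner_sub_right, hself, hself]
  have h3 : 0 ≤ (φ ‖p‖ - φ ‖p'‖) * (‖p‖ - ‖p'‖) := by
    have hm := hφ.strictMonoOn.monotoneOn
    rcases le_total ‖p‖ ‖p'‖ with h | h
    · exact mul_nonneg_of_nonpos_of_nonpos
        (sub_nonpos.2 (hm (norm_nonneg p) (norm_nonneg p') h)) (sub_nonpos.2 h)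
    · exact mul_nonneg (sub_nonneg.2 (hm (norm_nonneg p') (norm_nonneg p) h))
        (sub_nonneg.2 h)
  nlinarith

end NonlinearFlux

/-! ### The horizontal frame and integration by parts -/

namespace Heis

variable {m : ℕ}

/-- The horizontal frame `X_1, …, X_m, Y_1, …, Y_m` as a family of vector fields. -/
def field (k : Fin m ⊕ Fin m) (q : Heis m) : Heis m :=
  Sum.elim (fun j => (Pi.single j 1, 0, 2 * q.2.1 j)) (fun j => (0, Pi.single j 1, -2 * q.1 j)) k

/-- The horizontal gradient in the frame `field`. -/
noncomputable def hgrad (u : Heis m → ℝ) (q : Heis m) : EuclideanSpace ℝ (Fin m ⊕ Fin m) :=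
  WithLp.toLp 2 fun k => fderiv ℝ u q (field k q)

/-- The horizontal divergence of a vector field given by its components in the frame `field`. -/
noncomputable def hdiv (B : Heis m → EuclideanSpace ℝ (Fin m ⊕ Fin m)) (q : Heis m) : ℝ :=
  ∑ k, fderiv ℝ (fun p => B p k) q (field k q)

@[simp] theorem hgrad_apply (u : Heis m → ℝ) (q : Heis m) (k : Fin m ⊕ Fin m) :
    hgrad u q k = fderiv ℝ u q (field k q) := rfl

theorem gradDot_eq_inner (u v : Heis m → ℝ) (q : Heis m) :
    gradDot u v q = inner ℝ (hgrad u q) (hgrad v q) := by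
  simp only [gradDot, PiLp.inner_apply, Fintype.sum_sum_type, Finset.sum_add_distrib, hgrad_apply,
    field, Sum.elim_inl, Sum.elim_inr, X, Y, RCLike.inner_apply, conj_trivial, mul_comm]

theorem gradNorm_eq_norm (u : Heis m → ℝ) (q : Heis m) : gradNorm u q = ‖hgrad u q‖ := by
  rw [gradNorm, gradDot_eq_inner, real_inner_self_eq_norm_sq, Real.sqrt_sq (norm_nonneg _)]

theorem contDiff_field {n : WithTop ℕ∞} (k : Fin m ⊕ Fin m) : ContDiff ℝ n (field k) := by
  rcases k with j | j
  · change ContDiff ℝ n fun q : Heis m => ((Pi.single j 1, 0, 2 * q.2.1 j) : Heis m)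
    fun_prop
  · change ContDiff ℝ n fun q : Heis m => ((0, Pi.single j 1, -2 * q.1 j) : Heis m)
    fun_prop

theorem inner_hgrad (a : EuclideanSpace ℝ (Fin m ⊕ Fin m)) (ζ : Heis m → ℝ) (q : Heis m) :
    inner ℝ a (hgrad ζ q) = fderiv ℝ ζ q (∑ k, a k • field k q) := by
  simp [PiLp.inner_apply, map_sum, mul_comm]

theorem contDiffAt_hgrad {u : Heis m → ℝ} {q : Heis m} {n k : WithTop ℕ∞}
    (hu : ContDiffAt ℝ n u q) (h : k + 1 ≤ n) : ContDiffAt ℝ k (hgrad u) q := by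
  rw [contDiffAt_euclidean]
  intro i
  exact (hu.fderiv_right h).clm_apply (contDiff_field i).contDiffAt

theorem continuous_hgrad {u : Heis m → ℝ} (hu : ContDiff ℝ 1 u) : Continuous (hgrad u) := by
  rw [continuous_iff_continuousAt]
  exact fun q => (contDiffAt_hgrad (k := 0) hu.contDiffAt (by simp)).continuousAt

/-- The horizontal fields are divergence free. -/
theorem integral_fderiv_field {h : Heis m → ℝ} (hh : ContDiff ℝ 1 h) (hc : HasCompactSupport h)
    (k : Fin m ⊕ Fin m) : ∫ q, fderiv ℝ h q (field k q) = 0 := by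
  have hcf := hc.fderiv (𝕜 := ℝ)
  have cf := hh.continuous_fderiv one_ne_zero
  have hd := hh.differentiable one_ne_zero
  let τ : Heis m := (0, 0, 1)
  -- Each field is a constant vector plus a linear coefficient `c` times `∂/∂t`. Since `c` does not
  -- depend on `t`, differentiating it along `τ` gives nothing.
  obtain ⟨e, c, hk, hcτ⟩ : ∃ (e : Heis m) (c : Heis m →L[ℝ] ℝ),
      (∀ q, field k q = e + c q • τ) ∧ c τ = 0 := by
    rcases k with j | j
    · refine ⟨(Pi.single j 1, 0, 0), (2 : ℝ) • ((ContinuousLinearMap.proj j).comp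
        ((ContinuousLinearMap.fst ℝ _ _).comp (ContinuousLinearMap.snd ℝ _ _))), ?_, ?_⟩
      · intro q; simp [field, τ]
      · simp [τ]
    · refine ⟨(0, Pi.single j 1, 0), (-2 : ℝ) • ((ContinuousLinearMap.proj j).comp
        (ContinuousLinearMap.fst ℝ _ _)), ?_, ?_⟩
      · intro q; simp [field, τ]
      · simp [τ]
  have hcv : ∀ v : Heis m, HasCompactSupport fun q => fderiv ℝ h q v := fun v =>
    hcf.comp_left (g := fun L : Heis m →L[ℝ] ℝ => L v) rfl
  have i1 : Integrable fun q => fderiv ℝ h q e :=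
    (cf.clm_apply continuous_const).integrable_of_hasCompactSupport (hcv e)
  have i2 : Integrable fun q => c q * fderiv ℝ h q τ :=
    (c.continuous.mul (cf.clm_apply continuous_const)).integrable_of_hasCompactSupport
      (hcv τ).mul_left
  have s1 : ∫ q, fderiv ℝ h q e = 0 := by
    have := integral_mul_fderiv_eq_neg_fderiv_mul_of_integrable (μ := volume)
      (f := fun _ : Heis m => (1 : ℝ)) (g := h) (v := e) (by simp) (by simpa using i1)
      (by simpa using hh.continuous.integrable_of_hasCompactSupport hc)
      (fun x _ => by fun_prop) (fun x _ => hd x)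
    simpa using this
  have s2 : ∫ q, c q * fderiv ℝ h q τ = 0 := by
    have := integral_mul_fderiv_eq_neg_fderiv_mul_of_integrable (μ := volume)
      (f := fun q : Heis m => c q) (g := h) (v := τ) (by simp [hcτ]) i2
      ((c.continuous.mul hh.continuous).integrable_of_hasCompactSupport hc.mul_left)
      (fun x _ => c.differentiableAt) (fun x _ => hd x)
    simpa [hcτ] using this
  calc ∫ q, fderiv ℝ h q (field k q)
      = ∫ q, (fderiv ℝ h q e + c q * fderiv ℝ h q τ) := by simp [hk]
    _ = 0 := by rw [integral_add i1 i2, s1, s2, add_zero]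

/-- The integrand is the sum over `k` of the derivatives of `B_k ζ` along the fields. These products
are globally `C^1`, vanishing near every point off the support of `ζ`, so `B` need only be regular
on that support. -/
theorem integral_hdiv_mul_add_inner {B : Heis m → EuclideanSpace ℝ (Fin m ⊕ Fin m)}
    {ζ : Heis m → ℝ} (hζ : ContDiff ℝ 1 ζ) (hc : HasCompactSupport ζ)
    (hB : ∀ q ∈ tsupport ζ, ContDiffAt ℝ 1 B q) :
    Integrable (fun q => hdiv B q * ζ q + inner ℝ (B q) (hgrad ζ q)) ∧
      ∫ q, (hdiv B q * ζ q + inner ℝ (B q) (hgrad ζ q)) = 0 := by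
  have hBk : ∀ k, ∀ q ∈ tsupport ζ, ContDiffAt ℝ 1 (fun p => B p k) q := fun k q hq =>
    contDiffAt_euclidean.1 (hB q hq) k
  have hC : ∀ k, ContDiff ℝ 1 fun q => B q k * ζ q := by
    intro k
    refine contDiff_iff_contDiffAt.2 fun q => ?_
    by_cases hq : q ∈ tsupport ζ
    · exact (hBk k q hq).mul hζ.contDiffAt
    · have : (fun q => B q k * ζ q) =ᶠ[𝓝 q] fun _ => 0 := by
        filter_upwards [notMem_tsupport_iff_eventuallyEq.1 hq] with p hp
        simp [hp]
      exact contDiffAt_const.congr_of_eventuallyEq this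
  have hS : ∀ k, HasCompactSupport fun q => B q k * ζ q := fun k => hc.mul_left
  have key : (fun q => hdiv B q * ζ q + inner ℝ (B q) (hgrad ζ q))
      = fun q => ∑ k, fderiv ℝ (fun p => B p k * ζ p) q (field k q) := by
    funext q
    by_cases hq : q ∈ tsupport ζ
    · have : ∀ k, fderiv ℝ (fun p => B p k * ζ p) q (field k q)
          = fderiv ℝ (fun p => B p k) q (field k q) * ζ q + B q k * fderiv ℝ ζ q (field k q) := by
        intro k
        rw [fderiv_fun_mul ((hBk k q hq).differentiableAt one_ne_zero)
          (hζ.differentiable one_ne_zero q)]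
        simp; ring
      simp only [this, hdiv, Finset.sum_add_distrib, Finset.sum_mul, PiLp.inner_apply, hgrad_apply,
        RCLike.inner_apply, conj_trivial]
      exact congrArg _ (Finset.sum_congr rfl fun k _ => mul_comm _ _)
    · have h1 : ζ q = 0 := image_eq_zero_of_notMem_tsupport hq
      have h2 : fderiv ℝ ζ q = 0 :=
        image_eq_zero_of_notMem_tsupport (fun h => hq (tsupport_fderiv_subset ℝ h))
      have h3 : ∀ k, fderiv ℝ (fun p => B p k * ζ p) q = 0 := by
        intro k
        have : (fun q => B q k * ζ q) =ᶠ[𝓝 q] fun _ => 0 := by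
          filter_upwards [notMem_tsupport_iff_eventuallyEq.1 hq] with p hp
          simp [hp]
        rw [this.fderiv_eq]; simp
      rw [inner_hgrad]
      simp [h1, h2, h3]
  have hi : ∀ k, Integrable fun q => fderiv ℝ (fun p => B p k * ζ p) q (field k q) := by
    intro k
    refine Continuous.integrable_of_hasCompactSupport
      (((hC k).continuous_fderiv one_ne_zero).clm_apply (contDiff_field (n := 0) k).continuous) ?_
    refine HasCompactSupport.intro ((hS k).fderiv (𝕜 := ℝ)).isCompact fun q hq => ?_
    rw [image_eq_zero_of_notMem_tsupport hq]; simp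
  rw [key]
  refine ⟨integrable_finsetSum _ fun k _ => hi k, ?_⟩
  rw [integral_finsetSum _ fun k _ => hi k]
  exact Finset.sum_eq_zero fun k _ => integral_fderiv_field (hC k) (hS k) k

/-- Needed because the test function used later is built from `u`, hence only `C^1`. -/
theorem IsWeakSolution.integral_nonpos {φ f l : ℝ → ℝ} (hφ : CondPhi φ)
    (hf : ContinuousOn f (Ici 0)) (hl : ContinuousOn l (Ici 0)) {u : Heis m → ℝ}
    (hu0 : ∀ q, 0 ≤ u q) (hu : IsWeakSolution φ f l u) {ζ : Heis m → ℝ}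
    (hζ : ContDiff ℝ 1 ζ) (hc : HasCompactSupport ζ) (h0 : ∀ q, 0 ≤ ζ q) :
    Integrable (fun q => f (u q) * l ‖hgrad u q‖ * ζ q
      + inner ℝ (radialFlux φ (hgrad u q)) (hgrad ζ q)) ∧
    ∫ q, (f (u q) * l ‖hgrad u q‖ * ζ q
      + inner ℝ (radialFlux φ (hgrad u q)) (hgrad ζ q)) ≤ 0 := by
  have hg := continuous_hgrad hu.1
  have hb : Continuous fun q => f (u q) * l ‖hgrad u q‖ :=
    (hf.comp_continuous hu.1.continuous hu0).mul
      (hl.comp_continuous hg.norm fun q => norm_nonneg _)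
  have hV : Continuous fun q => ∑ k, (radialFlux φ (hgrad u q)) k • field k q := by
    refine continuous_finsetSum _ fun k _ => ?_
    exact ((EuclideanSpace.proj (𝕜 := ℝ) k).continuous.comp
      ((continuous_radialFlux hφ).comp hg)).smul (contDiff_field (n := 0) k).continuous
  have int : ∀ {ξ : Heis m → ℝ}, ContDiff ℝ 1 ξ → HasCompactSupport ξ →
      Integrable (fun q => f (u q) * l ‖hgrad u q‖ * ξ q) ∧
      Integrable (fun q => fderiv ℝ ξ q (∑ k, (radialFlux φ (hgrad u q)) k • field k q)) := by
    intro ξ hξ hξc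
    refine ⟨(hb.mul hξ.continuous).integrable_of_hasCompactSupport hξc.mul_left,
      ((hξ.continuous_fderiv one_ne_zero).clm_apply hV).integrable_of_hasCompactSupport ?_⟩
    refine HasCompactSupport.intro (hξc.fderiv (𝕜 := ℝ)).isCompact fun q hq => ?_
    rw [image_eq_zero_of_notMem_tsupport hq]; simp
  simp only [inner_hgrad]
  refine ⟨(int hζ hc).1.add (int hζ hc).2,
    integral_nonpos_of_smooth_test volume hb hV (fun ξ hξ hξc hξ0 => ?_) hζ hc h0⟩
  obtain ⟨i1, i2⟩ := int (hξ.of_le (by exact_mod_cast le_top)) hξc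
  rw [integral_add i1 i2]
  have h := hu.2 ξ hξ hξc hξ0
  have e : ∀ q, (gradNorm u q)⁻¹ * φ (gradNorm u q) * gradDot u ξ q
      = fderiv ℝ ξ q (∑ k, (radialFlux φ (hgrad u q)) k • field k q) := by
    intro q
    rw [← inner_hgrad, gradDot_eq_inner, gradNorm_eq_norm, radialFlux, real_inner_smul_left]
  simp only [e] at h
  simp only [gradNorm_eq_norm] at h
  linarith

/-! ### Weak solutions as viscosity subsolutions -/

theorem continuousAt_hdiv {B : Heis m → EuclideanSpace ℝ (Fin m ⊕ Fin m)} {q : Heis m}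
    (hB : ContDiffAt ℝ 1 B q) : ContinuousAt (hdiv B) q := by
  refine tendsto_finsetSum _ fun k _ => ?_
  exact ((((contDiffAt_euclidean.1 hB k).fderiv_right (m := 0) (by simp)).clm_apply
    (contDiff_field k).contDiffAt).continuousAt)

/-- `ζ = χ_K G(v)`, with `G` the standard smooth function vanishing on `(-∞, 0]`, is of class
`C^1` when `v` is `C^1` near the closed ball `K` and negative on its boundary sphere. -/
theorem contDiff_indicator_expNegInvGlue {v : Heis m → ℝ} {q₀ : Heis m} {r : ℝ}
    (hv : ∀ q ∈ Metric.closedBall q₀ r, ContDiffAt ℝ 1 v q)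
    (hneg : ∀ q ∈ Metric.sphere q₀ r, v q < 0) :
    ContDiff ℝ 1 ((Metric.closedBall q₀ r).indicator fun q => expNegInvGlue (v q)) := by
  refine contDiff_iff_contDiffAt.2 fun q => ?_
  rcases lt_trichotomy (dist q q₀) r with h | h | h
  · have hq : q ∈ Metric.closedBall q₀ r := h.le
    have h1 : ContDiffAt ℝ 1 (fun q => expNegInvGlue (v q)) q :=
      (expNegInvGlue.contDiff (n := 1)).contDiffAt.comp q (hv q hq)
    refine h1.congr_of_eventuallyEq ?_
    filter_upwards [Metric.isOpen_ball.mem_nhds h] with p hp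
    rw [indicator_of_mem (Metric.ball_subset_closedBall hp)]
  · refine (contDiffAt_const (c := (0 : ℝ))).congr_of_eventuallyEq ?_
    have hq : q ∈ Metric.closedBall q₀ r := h.le
    filter_upwards [(hv q hq).continuousAt.eventually_lt_const (hneg q h)] with p hp
    exact indicator_apply_eq_zero.2 fun _ => expNegInvGlue.zero_of_nonpos hp.le
  · refine (contDiffAt_const (c := (0 : ℝ))).congr_of_eventuallyEq ?_
    filter_upwards [Metric.isClosed_closedBall.isOpen_compl.mem_nhds
      (show q ∈ (Metric.closedBall q₀ r)ᶜ by simpa using h)] with p hp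
    rw [indicator_of_notMem hp]

/-- If the inequality failed, the defect would exceed some `c > 0` on a small ball. Test both the
weak inequality for `u` and the divergence identity for the flux of `w` with a cut-off increasing
function `ζ` of `u - w`, and subtract. Monotonicity of the flux makes the gradient term
non-negative, so `c ∫ ζ ≤ 0`, although `ζ q₀ > 0`. -/
theorem touching_of_strict {φ f l : ℝ → ℝ} (hφ : CondPhi φ)
    (hf : ContinuousOn f (Ici 0)) (hl : ContinuousOn l (Ici 0)) {u : Heis m → ℝ}
    (hu0 : ∀ q, 0 ≤ u q) (hu : IsWeakSolution φ f l u) {w : Heis m → ℝ} {q₀ : Heis m}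
    (hw : ContDiffAt ℝ 2 w q₀) (hne : hgrad w q₀ ≠ 0)
    (hmax : ∀ᶠ q in 𝓝 q₀, q ≠ q₀ → u q - w q < u q₀ - w q₀) :
    f (u q₀) * l ‖hgrad w q₀‖ ≤ hdiv (fun q => radialFlux φ (hgrad w q)) q₀ := by
  by_contra! hlt
  have hw1 : ContDiffAt ℝ 1 w q₀ := hw.of_le one_le_two
  have hud := hu.1.differentiable one_ne_zero
  have hloc : IsLocalMax (fun q => u q - w q) q₀ := by
    filter_upwards [hmax] with q hq
    rcases eq_or_ne q q₀ with rfl | h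
    · exact le_rfl
    · exact (hq h).le
  have hgeq : hgrad u q₀ = hgrad w q₀ := by
    have h := hloc.fderiv_eq_zero
    rw [fderiv_fun_sub (hud q₀) (hw1.differentiableAt one_ne_zero), sub_eq_zero] at h
    simp only [hgrad, h]
  set B := fun q => radialFlux φ (hgrad w q) with hBdef
  have hB : ContDiffAt ℝ 1 B q₀ :=
    (contDiffAt_radialFlux hφ hne).comp q₀
      (contDiffAt_hgrad hw (by rw [one_add_one_eq_two]))
  have hg := continuous_hgrad hu.1
  have hb : Continuous fun q => f (u q) * l ‖hgrad u q‖ :=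
    (hf.comp_continuous hu.1.continuous hu0).mul
      (hl.comp_continuous hg.norm fun q => norm_nonneg _)
  set c := (f (u q₀) * l ‖hgrad w q₀‖ - hdiv B q₀) / 2 with hc
  have hc0 : 0 < c := by rw [hc]; linarith
  have ev1 : ∀ᶠ q in 𝓝 q₀, c < f (u q) * l ‖hgrad u q‖ - hdiv B q := by
    refine (hb.continuousAt.sub (continuousAt_hdiv hB)).eventually_const_lt ?_
    change c < f (u q₀) * l ‖hgrad u q₀‖ - hdiv B q₀
    rw [hgeq, hc]; linarith
  obtain ⟨r, hr, H⟩ := Metric.nhds_basis_closedBall.eventually_iff.1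
    (ev1.and ((hB.eventually (by simp)).and ((hw1.eventually (by simp)).and hmax)))
  have hucont := hu.1.continuous
  -- Strictness of the maximum leaves a gap on the sphere; half of it is `δ`. So `v` below is
  -- negative on the sphere while `v q₀ = δ > 0`.
  obtain ⟨δ, hδ, hδs⟩ : ∃ δ > 0, ∀ q ∈ Metric.sphere q₀ r,
      u q - w q - (u q₀ - w q₀) + δ < 0 := by
    rcases (Metric.sphere q₀ r).eq_empty_or_nonempty with he | hn
    · exact ⟨1, one_pos, by simp [he]⟩
    · have hco : ContinuousOn (fun q => u q - w q) (Metric.sphere q₀ r) := fun q hq =>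
        (hucont.continuousAt.sub
          (H (Metric.sphere_subset_closedBall hq)).2.2.1.continuousAt).continuousWithinAt
      obtain ⟨p, hp, hpm⟩ := (isCompact_sphere q₀ r).exists_isMaxOn hn hco
      have hpne : p ≠ q₀ := by rintro rfl; simp at hp; linarith
      have h1 := (H (Metric.sphere_subset_closedBall hp)).2.2.2 hpne
      refine ⟨(u q₀ - w q₀ - (u p - w p)) / 2, by linarith, fun q hq => ?_⟩
      have h2 : u q - w q ≤ u p - w p := hpm hq
      linarith
  set v := fun q => u q - w q - (u q₀ - w q₀) + δ with hvdef
  set K := Metric.closedBall q₀ r with hK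
  set ζ := K.indicator fun q => expNegInvGlue (v q) with hζdef
  have hvC : ∀ q ∈ K, ContDiffAt ℝ 1 v q := fun q hq =>
    ((hu.1.contDiffAt.sub (H hq).2.2.1).sub contDiffAt_const).add contDiffAt_const
  have hζ : ContDiff ℝ 1 ζ := contDiff_indicator_expNegInvGlue hvC hδs
  have hsupp : tsupport ζ ⊆ K :=
    closure_minimal (fun q hq => by_contra fun h => hq (indicator_of_notMem h _))
      Metric.isClosed_closedBall
  have hζc : HasCompactSupport ζ :=
    (isCompact_closedBall q₀ r).of_isClosed_subset (isClosed_tsupport _) hsupp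
  have hζ0 : ∀ q, 0 ≤ ζ q := fun q => indicator_nonneg (fun _ _ => expNegInvGlue.nonneg _) q
  have hζq₀ : 0 < ζ q₀ := by
    rw [hζdef, indicator_of_mem (Metric.mem_closedBall_self hr.le)]
    exact expNegInvGlue.pos_of_pos (by simp [hvdef, hδ])
  -- On the support `∇ζ = G'(v) (∇u - ∇w)` with `G' ≥ 0`.
  have hmono : ∀ q, 0 ≤ inner ℝ (radialFlux φ (hgrad u q) - B q) (hgrad ζ q) := by
    intro q
    by_cases hq : q ∈ tsupport ζ
    · have hqK := hsupp hq
      have hqb : q ∈ Metric.ball q₀ r := by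
        rcases (Metric.mem_closedBall.1 hqK).lt_or_eq with h | h
        · exact h
        · exfalso
          refine notMem_tsupport_iff_eventuallyEq.2 ?_ hq
          filter_upwards [(hvC q hqK).continuousAt.eventually_lt_const (hδs q h)] with p hp
          exact indicator_apply_eq_zero.2 fun _ => expNegInvGlue.zero_of_nonpos hp.le
      have heq : ζ =ᶠ[𝓝 q] fun q => expNegInvGlue (v q) := by
        filter_upwards [Metric.isOpen_ball.mem_nhds hqb] with p hp
        rw [hζdef, indicator_of_mem (Metric.ball_subset_closedBall hp)]
      have hvd : HasFDerivAt v (fderiv ℝ u q - fderiv ℝ w q) q := by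
        have := ((hud q).hasFDerivAt.sub
          ((H hqK).2.2.1.differentiableAt one_ne_zero).hasFDerivAt)
        exact (this.sub_const (u q₀ - w q₀)).add_const δ
      have hGd : HasDerivAt expNegInvGlue (deriv expNegInvGlue (v q)) (v q) :=
        ((expNegInvGlue.contDiff (n := 1)).differentiable (by simp) _).hasDerivAt
      have hfd : fderiv ℝ ζ q = deriv expNegInvGlue (v q) • (fderiv ℝ u q - fderiv ℝ w q) := by
        rw [heq.fderiv_eq]
        exact (hGd.comp_hasFDerivAt q hvd).fderiv
      have hgz : hgrad ζ q = deriv expNegInvGlue (v q) • (hgrad u q - hgrad w q) := by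
        ext k
        simp [hfd]
      rw [hgz, real_inner_smul_right]
      exact mul_nonneg expNegInvGlue.monotone.deriv_nonneg (radialFlux_monotone hφ _ _)
    · rw [inner_hgrad, image_eq_zero_of_notMem_tsupport
        (fun h => hq (tsupport_fderiv_subset ℝ h))]
      simp
  obtain ⟨i1, j1⟩ := hu.integral_nonpos hφ hf hl hu0 hζ hζc hζ0
  obtain ⟨i2, j2⟩ := integral_hdiv_mul_add_inner hζ hζc fun q hq => (H (hsupp hq)).2.1
  have hpos : 0 < ∫ q, ζ q :=
    hζ.continuous.integral_pos_of_hasCompactSupport_nonneg_nonzero hζc hζ0 hζq₀.ne'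
  have hle : ∫ q, c * ζ q ≤ ∫ q, ((f (u q) * l ‖hgrad u q‖ * ζ q
      + inner ℝ (radialFlux φ (hgrad u q)) (hgrad ζ q))
      - (hdiv B q * ζ q + inner ℝ (B q) (hgrad ζ q))) := by
    refine integral_mono ((hζ.continuous.integrable_of_hasCompactSupport hζc).const_mul c)
      (i1.sub i2) fun q => ?_
    have hm := hmono q
    rw [inner_sub_left] at hm
    have h1 : c * ζ q ≤ (f (u q) * l ‖hgrad u q‖ - hdiv B q) * ζ q := by
      by_cases hq : q ∈ K
      · exact mul_le_mul_of_nonneg_right (H hq).1.le (hζ0 q)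
      · rw [hζdef, indicator_of_notMem hq]; simp
    simp only
    linarith
  rw [integral_sub i1 i2, j2, integral_const_mul] at hle
  have : 0 < c * ∫ q, ζ q := mul_pos hc0 hpos
  linarith

/-- A `C^1` weak solution of `Δ^φ u ≥ f(u) l(|∇u|)` is a viscosity solution at points where the
horizontal gradient does not vanish. -/
theorem touching {φ f l : ℝ → ℝ} (hφ : CondPhi φ)
    (hf : ContinuousOn f (Ici 0)) (hl : ContinuousOn l (Ici 0)) {u : Heis m → ℝ}
    (hu0 : ∀ q, 0 ≤ u q) (hu : IsWeakSolution φ f l u) {w : Heis m → ℝ} {q₀ : Heis m}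
    (hw : ContDiffAt ℝ 2 w q₀) (hne : hgrad w q₀ ≠ 0)
    (hmax : IsLocalMax (fun q => u q - w q) q₀) :
    f (u q₀) * l ‖hgrad w q₀‖ ≤ hdiv (fun q => radialFlux φ (hgrad w q)) q₀ := by
  let R : Heis m → ℝ := fun q =>
    ∑ j, (q.1 j - q₀.1 j) ^ 2 + ∑ j, (q.2.1 j - q₀.2.1 j) ^ 2 + (q.2.2 - q₀.2.2) ^ 2
  have hR : ContDiff ℝ 2 R := by fun_prop
  have hR0 : R q₀ = 0 := by simp [R]
  have hRpos : ∀ q, q ≠ q₀ → 0 < R q := by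
    intro q hq
    have h1 : 0 ≤ ∑ j, (q.1 j - q₀.1 j) ^ 2 := Finset.sum_nonneg fun j _ => sq_nonneg _
    have h2 : 0 ≤ ∑ j, (q.2.1 j - q₀.2.1 j) ^ 2 := Finset.sum_nonneg fun j _ => sq_nonneg _
    have h3 := sq_nonneg (q.2.2 - q₀.2.2)
    by_contra! h
    have e1 : ∑ j, (q.1 j - q₀.1 j) ^ 2 = 0 := by simp only [R] at h; linarith
    have e2 : ∑ j, (q.2.1 j - q₀.2.1 j) ^ 2 = 0 := by simp only [R] at h; linarith
    have e3 : (q.2.2 - q₀.2.2) ^ 2 = 0 := by simp only [R] at h; linarith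
    rw [Finset.sum_eq_zero_iff_of_nonneg fun j _ => sq_nonneg _] at e1 e2
    apply hq
    ext j
    · exact sub_eq_zero.1 (pow_eq_zero_iff two_ne_zero |>.1 (e1 j (Finset.mem_univ _)))
    · exact sub_eq_zero.1 (pow_eq_zero_iff two_ne_zero |>.1 (e2 j (Finset.mem_univ _)))
    · exact sub_eq_zero.1 (pow_eq_zero_iff two_ne_zero |>.1 e3)
  have hRd : fderiv ℝ R q₀ = 0 := by
    refine IsLocalMin.fderiv_eq_zero (Eventually.of_forall fun q => ?_)
    rcases eq_or_ne q q₀ with rfl | h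
    · exact le_rfl
    · rw [hR0]; exact (hRpos q h).le
  -- Adding `R ^ 2` makes the maximum strict. The square is used because `R ^ 2` vanishes to fourth
  -- order at `q₀`, so neither the gradient nor the divergence at `q₀` changes; `R` itself would
  -- alter second derivatives.
  set w' : Heis m → ℝ := fun q => w q + R q ^ 2 with hw'
  have hw'C : ContDiffAt ℝ 2 w' q₀ := hw.add (hR.pow 2).contDiffAt
  have hRdiff := hR.differentiable two_ne_zero
  have hgr : hgrad w' =ᶠ[𝓝 q₀] fun q => hgrad w q + (2 * R q) • hgrad R q := by
    filter_upwards [hw.eventually (by simp)] with q hq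
    ext k
    have h1 : HasFDerivAt w' (fderiv ℝ w q + (2 * R q) • fderiv ℝ R q) q :=
      ((hq.differentiableAt two_ne_zero).hasFDerivAt.add
        ((hRdiff q).hasFDerivAt.pow 2)).congr_fderiv (by simp)
    simp [h1.fderiv]
  have hgw : HasFDerivAt (hgrad w) (fderiv ℝ (hgrad w) q₀) q₀ :=
    ((contDiffAt_hgrad (k := 1) hw (by rw [one_add_one_eq_two])).differentiableAt
      one_ne_zero).hasFDerivAt
  have hgRd : HasFDerivAt (hgrad R) (fderiv ℝ (hgrad R) q₀) q₀ :=
    ((contDiffAt_hgrad (k := 1) hR.contDiffAt (by rw [one_add_one_eq_two])).differentiableAt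
      one_ne_zero).hasFDerivAt
  have hval : hgrad w' q₀ = hgrad w q₀ := by rw [hgr.eq_of_nhds]; simp [hR0]
  have hgw' : HasFDerivAt (hgrad w') (fderiv ℝ (hgrad w) q₀) q₀ := by
    have h1 := hgw.add ((((hRdiff q₀).hasFDerivAt.const_mul 2)).smul hgRd)
    have h2 : HasFDerivAt (fun q => hgrad w q + (2 * R q) • hgrad R q)
        (fderiv ℝ (hgrad w) q₀) q₀ := by
      refine h1.congr_fderiv ?_
      simp [hR0, hRd]
    exact h2.congr_of_eventuallyEq hgr
  have hAd := ((contDiffAt_radialFlux hφ hne).differentiableAt one_ne_zero).hasFDerivAt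
  have hBw := hAd.comp q₀ hgw
  have hAd' : HasFDerivAt (radialFlux φ) (fderiv ℝ (radialFlux φ) (hgrad w q₀)) (hgrad w' q₀) := by
    rw [hval]; exact hAd
  have hBw' := hAd'.comp q₀ hgw'
  have hdiveq : hdiv (fun q => radialFlux φ (hgrad w' q)) q₀
      = hdiv (fun q => radialFlux φ (hgrad w q)) q₀ := by
    refine Finset.sum_congr rfl fun k _ => ?_
    have e1 := ((EuclideanSpace.proj (𝕜 := ℝ) k).hasFDerivAt.comp q₀ hBw).fderiv
    have e2 := ((EuclideanSpace.proj (𝕜 := ℝ) k).hasFDerivAt.comp q₀ hBw').fderiv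
    exact congrArg (fun L : Heis m →L[ℝ] ℝ => L (field k q₀)) (e2.trans e1.symm)
  rw [← hdiveq, ← hval]
  refine touching_of_strict hφ hf hl hu0 hu hw'C (by rwa [hval]) ?_
  filter_upwards [hmax] with q hq hqne
  have := pow_pos (hRpos q hqne) 2
  simp only [hw', hR0]
  linarith

/-! ### Calculus of the Korányi gauge -/

/-- The horizontal coordinates `x_1, …, x_m, y_1, …, y_m`. -/
noncomputable def hcoord (k : Fin m ⊕ Fin m) : Heis m →L[ℝ] ℝ :=
  Sum.elim
    (fun j => (ContinuousLinearMap.proj j).comp (ContinuousLinearMap.fst ℝ _ _))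
    (fun j => (ContinuousLinearMap.proj j).comp
      ((ContinuousLinearMap.fst ℝ _ _).comp (ContinuousLinearMap.snd ℝ _ _))) k

@[simp] theorem hcoord_inl (j : Fin m) (q : Heis m) : hcoord (Sum.inl j) q = q.1 j := rfl

@[simp] theorem hcoord_inr (j : Fin m) (q : Heis m) : hcoord (Sum.inr j) q = q.2.1 j := rfl

/-- The linear part of the last coordinate of `h⁻¹ q`. -/
noncomputable def htLin (h : Heis m) : Heis m →L[ℝ] ℝ :=
  (ContinuousLinearMap.snd ℝ _ _).comp (ContinuousLinearMap.snd ℝ _ _)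
    - (2 : ℝ) • ∑ j, h.2.1 j • hcoord (Sum.inl j) + (2 : ℝ) • ∑ j, h.1 j • hcoord (Sum.inr j)

theorem htLin_apply (h q : Heis m) :
    htLin h q = q.2.2 - 2 * ∑ j, h.2.1 j * q.1 j + 2 * ∑ j, h.1 j * q.2.1 j := by
  simp [htLin]

/-- The last coordinate of `h⁻¹ q`. -/
noncomputable def ht (h q : Heis m) : ℝ := htLin h q - h.2.2

/-- The horizontal coordinates of `h⁻¹ q`. -/
noncomputable def off (h q : Heis m) (k : Fin m ⊕ Fin m) : ℝ := hcoord k q - hcoord k h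

/-- The rotation by a quarter turn of `off`. -/
noncomputable def rot (h q : Heis m) (k : Fin m ⊕ Fin m) : ℝ :=
  Sum.elim (fun j => off h q (Sum.inr j)) (fun j => -off h q (Sum.inl j)) k

/-- The squared length of the horizontal part of `h⁻¹ q`. -/
noncomputable def sq (h q : Heis m) : ℝ := ∑ k, off h q k ^ 2

/-- The fourth power of the Korányi gauge of `h⁻¹ q`. -/
noncomputable def gauge4 (h q : Heis m) : ℝ := sq h q ^ 2 + ht h q ^ 2

/-- The Korányi gauge of `h⁻¹ q`. -/
noncomputable def gauge (h q : Heis m) : ℝ := gauge4 h q ^ (1 / 4 : ℝ)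

/-- A quarter of the horizontal gradient of `gauge4 h`. -/
noncomputable def gvec (h q : Heis m) (k : Fin m ⊕ Fin m) : ℝ :=
  sq h q * off h q k + ht h q * rot h q k

theorem sqDist_nonneg (h q : Heis m) : 0 ≤ sq h q := Finset.sum_nonneg fun _ _ => sq_nonneg _

theorem gauge4_nonneg (h q : Heis m) : 0 ≤ gauge4 h q := by unfold gauge4; positivity

theorem gauge_nonneg (h q : Heis m) : 0 ≤ gauge h q := Real.rpow_nonneg (gauge4_nonneg h q) _

theorem gauge_pow_four (h q : Heis m) : gauge h q ^ 4 = gauge4 h q := by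
  rw [gauge, ← Real.rpow_natCast, ← Real.rpow_mul (gauge4_nonneg h q)]
  norm_num

theorem gauge_pos {h q : Heis m} (hq : 0 < gauge4 h q) : 0 < gauge h q := Real.rpow_pos_of_pos hq _

theorem sq_le_gauge_sq (h q : Heis m) : sq h q ≤ gauge h q ^ 2 := by
  refine abs_le_of_sq_le_sq' ?_ (sq_nonneg _) |>.2
  rw [← pow_mul, gauge_pow_four, gauge4]
  nlinarith [sq_nonneg (ht h q)]

theorem sum_off_mul_rot (h q : Heis m) : ∑ k, off h q k * rot h q k = 0 := by
  simp only [rot, Fintype.sum_sum_type, Sum.elim_inl, Sum.elim_inr, ← Finset.sum_add_distrib]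
  exact Finset.sum_eq_zero fun j _ => by ring

theorem sum_rot_sq (h q : Heis m) : ∑ k, rot h q k ^ 2 = sq h q := by
  simp only [sq, rot, Fintype.sum_sum_type, Sum.elim_inl, Sum.elim_inr, neg_sq]
  exact add_comm _ _

theorem sum_gvec_mul_off (h q : Heis m) : ∑ k, gvec h q k * off h q k = sq h q ^ 2 := by
  have : ∀ k, gvec h q k * off h q k
      = sq h q * off h q k ^ 2 + ht h q * (off h q k * rot h q k) := fun k => by
    rw [gvec]; ring
  simp only [this, Finset.sum_add_distrib, ← Finset.mul_sum, sum_off_mul_rot]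
  rw [← sq]; ring

/-- The two parts of `gvec` are orthogonal and `rot` has the length of `off`. Consequently the gauge
has squared horizontal gradient `sq / gauge²`: at most 1, and zero, away from the centre, exactly on
the vertical axis. -/
theorem sum_gvec_sq (h q : Heis m) : ∑ k, gvec h q k ^ 2 = sq h q * gauge4 h q := by
  have : ∀ k, gvec h q k ^ 2 = sq h q ^ 2 * off h q k ^ 2
      + 2 * sq h q * ht h q * (off h q k * rot h q k) + ht h q ^ 2 * rot h q k ^ 2 := fun k => by
    rw [gvec]; ring
  simp only [this, Finset.sum_add_distrib, ← Finset.mul_sum, sum_off_mul_rot, sum_rot_sq]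
  rw [← sq, gauge4]; ring

theorem hcoord_field_self (k : Fin m ⊕ Fin m) (q : Heis m) : hcoord k (field k q) = 1 := by
  rcases k with j | j <;> simp [field]

theorem htLin_field (h : Heis m) (k : Fin m ⊕ Fin m) (q : Heis m) :
    htLin h (field k q) = 2 * rot h q k := by
  rcases k with j | j
  · simp [htLin_apply, field, rot, off, Pi.single_apply]; ring
  · simp [htLin_apply, field, rot, off, Pi.single_apply]; ring

theorem sum_off_mul_hcoord_field (h q : Heis m) (k : Fin m ⊕ Fin m) :
    ∑ i, off h q i * hcoord i (field k q) = off h q k := by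
  rcases k with j | j <;>
  simp [field, Fintype.sum_sum_type, Pi.single_apply]

theorem hasFDerivAt_ht (h q : Heis m) : HasFDerivAt (ht h) (htLin h) q :=
  (htLin h).hasFDerivAt.sub_const _

theorem hasFDerivAt_off (h q : Heis m) (k : Fin m ⊕ Fin m) :
    HasFDerivAt (fun p => off h p k) (hcoord k) q :=
  (hcoord k).hasFDerivAt.sub_const _

theorem contDiff_ht (h : Heis m) {n : WithTop ℕ∞} : ContDiff ℝ n (ht h) :=
  (htLin h).contDiff.sub contDiff_const

theorem contDiff_off (h : Heis m) (k : Fin m ⊕ Fin m) {n : WithTop ℕ∞} :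
    ContDiff ℝ n (fun p => off h p k) :=
  (hcoord k).contDiff.sub contDiff_const

theorem contDiff_sq (h : Heis m) {n : WithTop ℕ∞} : ContDiff ℝ n (sq h) :=
  ContDiff.sum fun k _ => (contDiff_off h k).pow 2

theorem contDiff_gauge4 (h : Heis m) {n : WithTop ℕ∞} : ContDiff ℝ n (gauge4 h) :=
  ((contDiff_sq h).pow 2).add ((contDiff_ht h).pow 2)

theorem continuous_gauge (h : Heis m) : Continuous (gauge h) :=
  (contDiff_gauge4 (n := 0) h).continuous.rpow_const fun _ => Or.inr (by norm_num)

theorem contDiffAt_gauge {h q : Heis m} (hq : 0 < gauge4 h q) {n : WithTop ℕ∞} :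
    ContDiffAt ℝ n (gauge h) q :=
  (contDiff_gauge4 h).contDiffAt.rpow_const_of_ne hq.ne'

theorem hasFDerivAt_sq (h q : Heis m) :
    ∃ L : Heis m →L[ℝ] ℝ, HasFDerivAt (sq h) L q ∧ ∀ k, L (field k q) = 2 * off h q k := by
  have h1 : HasFDerivAt (sq h) (∑ i, (2 * off h q i) • hcoord i) q := by
    have := HasFDerivAt.fun_sum (u := Finset.univ) fun i _ => (hasFDerivAt_off h q i).pow 2
    refine this.congr_fderiv ?_
    simp
  refine ⟨_, h1, fun k => ?_⟩
  rw [← sum_off_mul_hcoord_field, sum_apply, Finset.mul_sum]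
  exact Finset.sum_congr rfl fun i _ => by
    rw [smul_apply, smul_eq_mul, mul_assoc]

theorem hasFDerivAt_gauge {h q : Heis m} (hq : 0 < gauge4 h q) :
    ∃ L : Heis m →L[ℝ] ℝ, HasFDerivAt (gauge h) L q ∧
      ∀ k, L (field k q) = gvec h q k / gauge h q ^ 3 := by
  obtain ⟨S, hS, hSk⟩ := hasFDerivAt_sq h q
  have h4 : HasFDerivAt (gauge4 h) ((2 * sq h q) • S + (2 * ht h q) • htLin h) q :=
    ((hS.pow 2).add ((hasFDerivAt_ht h q).pow 2)).congr_fderiv (by simp)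
  have hg := h4.rpow_const (p := 1 / 4) (Or.inl hq.ne')
  refine ⟨_, hg, fun k => ?_⟩
  have hρ := gauge_pos hq
  have e : gauge4 h q ^ ((1 / 4 : ℝ) - 1) = 1 / gauge h q ^ 3 := by
    rw [Real.rpow_sub_one hq.ne', ← gauge, ← gauge_pow_four]
    field_simp
  simp only [smul_apply, add_apply, smul_eq_mul, hSk,
    htLin_field, e, gvec]
  ring

theorem hgrad_gauge {h q : Heis m} (hq : 0 < gauge4 h q) (ε : ℝ) (k : Fin m ⊕ Fin m) :
    hgrad (fun p => ε * gauge h p) q k = ε / gauge h q ^ 3 * gvec h q k := by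
  obtain ⟨L, hL, hLk⟩ := hasFDerivAt_gauge hq
  rw [hgrad_apply, (hL.const_mul ε).fderiv, smul_apply, hLk, smul_eq_mul]
  ring

theorem norm_hgrad_gauge {h q : Heis m} (hq : 0 < gauge4 h q) {ε : ℝ} (hε : 0 ≤ ε) :
    ‖hgrad (fun p => ε * gauge h p) q‖ = ε * √(sq h q / gauge h q ^ 2) := by
  have hρ := gauge_pos hq
  rw [EuclideanSpace.norm_eq]
  simp only [hgrad_gauge hq, Real.norm_eq_abs, sq_abs, mul_pow, ← Finset.mul_sum, sum_gvec_sq]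
  have e : ε * √(sq h q / gauge h q ^ 2) = √(ε ^ 2 * (sq h q / gauge h q ^ 2)) := by
    rw [Real.sqrt_mul (by positivity), Real.sqrt_sq hε]
  rw [e, ← gauge_pow_four]
  congr 1
  field_simp

/-- The operator `Δ^φ` applied to a multiple of the gauge. -/
theorem hdiv_radialFlux_gauge {φ : ℝ → ℝ} (hφ : CondPhi φ) {h q : Heis m} (hq : 0 < sq h q)
    {ε : ℝ} (hε : 0 < ε) :
    hdiv (fun p => radialFlux φ (hgrad (fun p => ε * gauge h p) p)) q
      = φ ‖hgrad (fun p => ε * gauge h p) q‖ * ((2 * m + 1) * √(sq h q) / gauge h q ^ 2) := by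
  have h4 : 0 < gauge4 h q := by unfold gauge4; positivity
  have hρ := gauge_pos h4
  obtain ⟨S, hS, hSk⟩ := hasFDerivAt_sq h q
  obtain ⟨L, hL, hLk⟩ := hasFDerivAt_gauge h4
  set ρ := gauge h q with hρdef
  set s := sq h q with hsdef
  -- The flux is `Θ(σ) (ε / ρ³) gvec` with `σ = sq / ρ²`. The horizontal gradients of `σ` and `ρ`
  -- are orthogonal, so the terms in the derivative `θ` cancel in the divergence and `φ'`
  -- disappears.
  set Θ : ℝ → ℝ := fun x => (ε * √x)⁻¹ * φ (ε * √x) with hΘ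
  have hσ0 : 0 < s / ρ ^ 2 := by positivity
  obtain ⟨θ, hθ⟩ : ∃ θ, HasDerivAt Θ θ (s * (1 / ρ ^ 2)) := by
    rw [mul_one_div]
    have h1 : DifferentiableAt ℝ (fun x => ε * √x) (s / ρ ^ 2) :=
      (Real.hasDerivAt_sqrt hσ0.ne').differentiableAt.const_mul ε
    have hp : 0 < ε * √(s / ρ ^ 2) := mul_pos hε (Real.sqrt_pos.2 hσ0)
    have h2 : DifferentiableAt ℝ φ (ε * √(s / ρ ^ 2)) :=
      (hφ.contDiffOn.contDiffAt (Ioi_mem_nhds hp)).differentiableAt one_ne_zero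
    exact ⟨_, ((h1.inv hp.ne').mul (h2.comp (s / ρ ^ 2) h1)).hasDerivAt⟩
  have d2 : HasDerivAt (fun x : ℝ => 1 / x ^ 2) (-2 / ρ ^ 3) ρ := by
    have := (hasDerivAt_pow 2 ρ).fun_inv (by positivity)
    simp only [one_div]
    refine this.congr_deriv ?_
    field_simp
    norm_num
    ring
  have d3 : HasDerivAt (fun x : ℝ => ε / x ^ 3) (-3 * ε / ρ ^ 4) ρ := by
    have := ((hasDerivAt_pow 3 ρ).fun_inv (by positivity)).const_mul ε
    simp only [div_eq_mul_inv]
    refine this.congr_deriv ?_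
    field_simp
    norm_num
    ring
  have hσ := hS.mul (d2.comp_hasFDerivAt q hL)
  have hK := (HasDerivAt.comp_hasFDerivAt (h₂ := Θ) q hθ hσ).mul (d3.comp_hasFDerivAt q hL)
  have hloc : ∀ᶠ p in 𝓝 q, ∀ k, radialFlux φ (hgrad (fun p => ε * gauge h p) p) k
      = Θ (sq h p * (1 / gauge h p ^ 2)) * (ε / gauge h p ^ 3) * gvec h p k := by
    filter_upwards [(contDiff_gauge4 (n := 0) h).continuous.continuousAt.eventually_const_lt h4]
      with p hp k
    simp only [radialFlux, PiLp.smul_apply, smul_eq_mul, hgrad_gauge hp, norm_hgrad_gauge hp hε.le,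
      hΘ, mul_one_div]
    ring
  have hgv : ∀ k, ∃ G : Heis m →L[ℝ] ℝ, HasFDerivAt (fun p => gvec h p k) G q ∧
      G (field k q) = s + 2 * off h q k ^ 2 + 2 * rot h q k ^ 2 := by
    intro k
    obtain ⟨R, hR, hRk⟩ : ∃ R : Heis m →L[ℝ] ℝ, HasFDerivAt (fun p => rot h p k) R q ∧
        R (field k q) = 0 := by
      rcases k with j | j
      · exact ⟨_, hasFDerivAt_off h q (Sum.inr j), by simp [field]⟩
      · exact ⟨_, (hasFDerivAt_off h q (Sum.inl j)).fun_neg, by simp [field]⟩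
    refine ⟨_, (hS.mul (hasFDerivAt_off h q k)).add ((hasFDerivAt_ht h q).mul hR), ?_⟩
    simp only [add_apply, smul_apply, smul_eq_mul, hSk,
      hcoord_field_self, htLin_field, hRk, hsdef]
    ring
  have hterm : ∀ k, fderiv ℝ (fun p => radialFlux φ (hgrad (fun p => ε * gauge h p) p) k) q
        (field k q)
      = Θ (s * (1 / ρ ^ 2)) * (ε / ρ ^ 3) * (s + 2 * off h q k ^ 2 + 2 * rot h q k ^ 2)
        + Θ (s * (1 / ρ ^ 2)) * (-3 * ε / ρ ^ 7) * gvec h q k ^ 2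
        + (ε / ρ ^ 3) * θ * (2 / ρ ^ 2) * (gvec h q k * off h q k)
        - (ε / ρ ^ 3) * θ * (2 * s / ρ ^ 6) * gvec h q k ^ 2 := by
    intro k
    obtain ⟨G, hG, hGk⟩ := hgv k
    have e : (fun p => radialFlux φ (hgrad (fun p => ε * gauge h p) p) k) =ᶠ[𝓝 q]
        fun p => Θ (sq h p * (1 / gauge h p ^ 2)) * (ε / gauge h p ^ 3) * gvec h p k := by
      filter_upwards [hloc] with p hp using hp k
    have hd := hK.mul hG
    rw [e.fderiv_eq]
    refine (congrArg (fun M : Heis m →L[ℝ] ℝ => M (field k q)) hd.fderiv).trans ?_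
    simp only [add_apply, smul_apply, smul_eq_mul, hSk,
      hLk, hGk, Function.comp_apply, Pi.mul_apply, ← hρdef, ← hsdef]
    field_simp
    ring
  have hcard : ∑ _k : Fin m ⊕ Fin m, s = 2 * m * s := by
    rw [Finset.sum_const, Finset.card_univ, Fintype.card_sum, Fintype.card_fin, nsmul_eq_mul]
    push_cast
    ring
  have hg4 : gauge4 h q = ρ ^ 4 := (gauge_pow_four h q).symm
  -- The coefficient is `2m + 4` from the divergence of `gvec`, minus 3 from differentiating `ρ⁻³`.
  have hsum : hdiv (fun p => radialFlux φ (hgrad (fun p => ε * gauge h p) p)) q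
      = Θ (s * (1 / ρ ^ 2)) * (ε / ρ ^ 3) * ((2 * m + 1) * s) := by
    simp only [hdiv, hterm, Finset.sum_add_distrib, Finset.sum_sub_distrib, ← Finset.mul_sum,
      sum_gvec_sq, sum_gvec_mul_off, sum_rot_sq, hcard, hg4, ← hsdef]
    rw [show ∑ k, off h q k ^ 2 = s from rfl]
    field_simp
    ring
  rw [hsum, norm_hgrad_gauge h4 hε.le, ← hsdef, ← hρdef, hΘ, mul_one_div]
  have e1 : √(s / ρ ^ 2) = √s / ρ := by rw [Real.sqrt_div hq.le, Real.sqrt_sq hρ.le]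
  have e2 : s = √s ^ 2 := (Real.sq_sqrt hq.le).symm
  have e3 : 0 < √s := Real.sqrt_pos.2 hq
  simp only [e1]
  nth_rewrite 3 [e2]
  field_simp

/-- A bound on `gauge4 h` bounds the image of `q` under the linear map `Φ`, which is injective on a
finite-dimensional space and hence antilipschitz. -/
theorem tendsto_gauge4 (h : Heis m) : Tendsto (gauge4 h) (cocompact (Heis m)) atTop := by
  let Φ : Heis m →L[ℝ] Heis m := (ContinuousLinearMap.fst ℝ _ _).prod
    (((ContinuousLinearMap.fst ℝ _ _).comp (ContinuousLinearMap.snd ℝ _ _)).prod (htLin h))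
  have hΦ : ∀ q, Φ q = (q.1, q.2.1, htLin h q) := fun q => rfl
  have hker : LinearMap.ker Φ.toLinearMap = ⊥ := by
    refine LinearMap.ker_eq_bot'.2 fun q hq => ?_
    have h0 : (q.1, q.2.1, htLin h q) = (0 : Heis m) := hq
    have h1 : q.1 = 0 := congrArg Prod.fst h0
    have h2 : q.2.1 = 0 := congrArg (fun p => p.2.1) h0
    have h3 : htLin h q = 0 := congrArg (fun p => p.2.2) h0
    rw [htLin_apply] at h3
    simp only [h1, h2, Pi.zero_apply, mul_zero, Finset.sum_const_zero, sub_zero, add_zero] at h3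
    ext j
    · simp [h1]
    · simp [h2]
    · simp [h3]
  obtain ⟨A, hA, hAΦ⟩ := LinearMap.exists_antilipschitzWith Φ.toLinearMap hker
  refine tendsto_atTop.2 fun C => ?_
  -- With `C' ≥ 1`, a square bounded by `C'` has its root bounded by `C'` too.
  set C' := max C 1 with hC'
  have hC1 : 1 ≤ C' := le_max_right _ _
  have hCC : C ≤ C' := le_max_left _ _
  filter_upwards [(isCompact_closedBall (0 : Heis m) (A * (C' + ‖h‖))).compl_mem_cocompact]
    with q hq
  by_contra! hlt
  refine hq ?_
  rw [mem_closedBall_zero_iff]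
  have hs0 := sqDist_nonneg h q
  have hN : sq h q ^ 2 + ht h q ^ 2 < C' := lt_of_lt_of_le hlt hCC
  have hs : sq h q ≤ C' := by nlinarith [sq_nonneg (ht h q)]
  have ht' : |ht h q| ≤ C' := abs_le_of_sq_le_sq (by nlinarith [sq_nonneg (sq h q)]) (by linarith)
  have hoff : ∀ k, |off h q k| ≤ C' := fun k => by
    have : off h q k ^ 2 ≤ sq h q :=
      Finset.single_le_sum (f := fun k => off h q k ^ 2) (fun _ _ => sq_nonneg _)
        (Finset.mem_univ k)
    exact abs_le_of_sq_le_sq (by nlinarith) (by linarith)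
  have hpos : 0 ≤ C' + ‖h‖ := by positivity
  have hb : ‖Φ q‖ ≤ C' + ‖h‖ := by
    have hx : ∀ k, |hcoord k h| ≤ ‖h‖ → |hcoord k q| ≤ C' + ‖h‖ := fun k hk => by
      have e : hcoord k q = off h q k + hcoord k h := by simp [off]
      rw [e]
      exact (abs_add_le _ _).trans (add_le_add (hoff k) hk)
    rw [hΦ, Prod.norm_def, Prod.norm_def]
    refine max_le ?_ (max_le ?_ ?_)
    · refine (pi_norm_le_iff_of_nonneg hpos).2 fun j => hx (Sum.inl j) ?_
      exact (norm_le_pi_norm h.1 j).trans (norm_fst_le h)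
    · refine (pi_norm_le_iff_of_nonneg hpos).2 fun j => hx (Sum.inr j) ?_
      exact (norm_le_pi_norm h.2.1 j).trans ((norm_fst_le h.2).trans (norm_snd_le h))
    · have e : htLin h q = ht h q + h.2.2 := by simp [ht]
      change |htLin h q| ≤ _
      rw [e]
      exact (abs_add_le _ _).trans
        (add_le_add ht' ((norm_snd_le h.2).trans (norm_snd_le h)))
  have := hAΦ.le_mul_dist q 0
  simp only [map_zero, dist_zero_right] at this
  exact this.trans (mul_le_mul_of_nonneg_left hb A.2)

theorem eq_of_sq_eq_zero {h q : Heis m} (hs : sq h q = 0) : q.1 = h.1 ∧ q.2.1 = h.2.1 := by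
  have h0 : ∀ k, off h q k = 0 := fun k => by
    rw [sq, Finset.sum_eq_zero_iff_of_nonneg fun _ _ => sq_nonneg _] at hs
    exact pow_eq_zero_iff two_ne_zero |>.1 (hs k (Finset.mem_univ k))
  exact ⟨funext fun j => sub_eq_zero.1 (h0 (Sum.inl j)),
    funext fun j => sub_eq_zero.1 (h0 (Sum.inr j))⟩

theorem gauge4_pos {h q : Heis m} (hne : q ≠ h) : 0 < gauge4 h q := by
  by_contra! hle
  have h1 := sq_nonneg (sq h q)
  have h2 := sq_nonneg (ht h q)
  have hs : sq h q = 0 := pow_eq_zero_iff two_ne_zero |>.1 (by unfold gauge4 at hle; linarith)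
  have h3 : ht h q = 0 := pow_eq_zero_iff two_ne_zero |>.1 (by unfold gauge4 at hle; linarith)
  obtain ⟨e1, e2⟩ := eq_of_sq_eq_zero hs
  refine hne (Prod.ext e1 (Prod.ext e2 ?_))
  simp only [ht, htLin_apply, e1, e2, mul_comm (h.2.1 _)] at h3
  linarith

theorem tendsto_gauge (h : Heis m) : Tendsto (gauge h) (cocompact (Heis m)) atTop :=
  (tendsto_rpow_atTop (by norm_num)).comp (tendsto_gauge4 h)

/-! ### Choice of the centres and the comparison argument -/

/-- The group product `q₀ · (α e_j, β e_j, 0)`. -/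
noncomputable def shift (q₀ : Heis m) (j : Fin m) (α β : ℝ) : Heis m :=
  (q₀.1 + Pi.single j α, q₀.2.1 + Pi.single j β, q₀.2.2 - 2 * β * q₀.1 j + 2 * α * q₀.2.1 j)

theorem gauge4_shift (q₀ : Heis m) (j : Fin m) (α β α' β' t : ℝ) :
    gauge4 (shift q₀ j α' β') ((shift q₀ j α β).1, (shift q₀ j α β).2.1, t)
      = ((α - α') ^ 2 + (β - β') ^ 2) ^ 2
        + (t - (shift q₀ j α β).2.2 + 2 * (α' * β - β' * α)) ^ 2 := by
  have h1 : sq (shift q₀ j α' β') ((shift q₀ j α β).1, (shift q₀ j α β).2.1, t)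
      = (α - α') ^ 2 + (β - β') ^ 2 := by
    simp only [sq, off, Fintype.sum_sum_type, hcoord_inl, hcoord_inr, shift, Pi.add_apply,
      add_sub_add_left_eq_sub]
    rw [Finset.sum_eq_single j (fun b _ hb => by simp [hb]) (by simp),
      Finset.sum_eq_single j (fun b _ hb => by simp [hb]) (by simp)]
    simp
  have h2 : ht (shift q₀ j α' β') ((shift q₀ j α β).1, (shift q₀ j α β).2.1, t)
      = t - (shift q₀ j α β).2.2 + 2 * (α' * β - β' * α) := by
    simp only [ht, htLin_apply, shift, Pi.add_apply, add_mul, mul_add, Finset.sum_add_distrib,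
      Pi.single_apply, ite_mul, mul_ite, zero_mul, mul_zero, Finset.sum_ite_eq',
      Finset.mem_univ, if_true, mul_comm (q₀.2.1 _)]
    ring
  rw [gauge4, h1, h2]

/-- Three points near `q₀` such that, away from `q₀`, on the vertical axis through each of them
another one is strictly closer in the Korányi gauge. -/
theorem exists_staircase (hm : 1 ≤ m) {q₀ : Heis m} {O : Set (Heis m)} (hO : O ∈ 𝓝 q₀) :
    ∃ h : Fin 3 → Heis m, (∀ i, h i ∈ O) ∧
      ∀ q ∉ O, ∀ i, sq (h i) q = 0 → ∃ j, gauge4 (h j) q < gauge4 (h i) q := by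
  obtain ⟨s, hs, hsO⟩ := Metric.mem_nhds_iff.1 hO
  let j₀ : Fin m := ⟨0, hm⟩
  set A := q₀.1 j₀ with hA
  set B := q₀.2.1 j₀ with hB
  set C := |A| + |B| with hC
  have hC0 : 0 ≤ C := by positivity
  -- The shifts move the height by at most `2 a C`. Thus the centres stay in the ball, and on their
  -- axes outside `O` the relative height is at least `10 a > 8 a²`.
  set a := min 1 (s / (10 + 2 * C)) with ha
  have ha0 : 0 < a := by positivity
  have ha1 : a ≤ 1 := min_le_left _ _
  have ha2 : a * (10 + 2 * C) ≤ s := (le_div_iff₀ (by positivity)).1 (min_le_right _ _)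
  have haC : 0 ≤ a * C := by positivity
  -- The triangle `(a,0)`, `(0,a)`, `(-a,-a)` is oriented: seen from the next vertex the relative
  -- height `T` becomes `T - 2a²`, from the previous one `T + 2a²`. The price is a fourth power of
  -- distance at most `25a⁴`, so moving in the right direction gains once `4a²|T| > 29a⁴`, which
  -- `|T| > 8a²` ensures.
  let α : Fin 3 → ℝ := ![a, 0, -a]
  let β : Fin 3 → ℝ := ![0, a, -a]
  have hα : ∀ i, |α i| ≤ a := fun i => by fin_cases i <;> simp [α, abs_of_pos ha0, ha0.le]
  have hβ : ∀ i, |β i| ≤ a := fun i => by fin_cases i <;> simp [β, abs_of_pos ha0, ha0.le]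
  have hshift : ∀ i, |-2 * β i * A + 2 * α i * B| ≤ 2 * (a * C) := fun i => by
    have e1 : |β i * A| ≤ a * |A| := by
      rw [abs_mul]; exact mul_le_mul_of_nonneg_right (hβ i) (abs_nonneg _)
    have e2 : |α i * B| ≤ a * |B| := by
      rw [abs_mul]; exact mul_le_mul_of_nonneg_right (hα i) (abs_nonneg _)
    rw [abs_le] at e1 e2 ⊢
    rw [hC]
    constructor <;> linarith
  have hsingle : ∀ x : ℝ, |x| ≤ a → ‖(Pi.single j₀ x : Fin m → ℝ)‖ < s := fun x hx => by
    rw [Pi.norm_single, Real.norm_eq_abs]; nlinarith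
  have hmem : ∀ i t, |t - q₀.2.2| < s →
      ((shift q₀ j₀ (α i) (β i)).1, (shift q₀ j₀ (α i) (β i)).2.1, t) ∈ O := fun i t hts => by
    refine hsO ?_
    rw [mem_ball_iff_norm, Prod.norm_def, Prod.norm_def]
    refine max_lt ?_ (max_lt ?_ hts)
    · simpa [shift] using hsingle _ (hα i)
    · simpa [shift] using hsingle _ (hβ i)
  refine ⟨fun i => shift q₀ j₀ (α i) (β i), fun i => hmem i _ ?_, ?_⟩
  · have e : (shift q₀ j₀ (α i) (β i)).2.2 - q₀.2.2 = -2 * β i * A + 2 * α i * B := by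
      simp only [shift]; ring
    change |(shift q₀ j₀ (α i) (β i)).2.2 - q₀.2.2| < s
    rw [e]
    nlinarith [hshift i]
  · rintro ⟨x, y, t⟩ hq i hi
    obtain ⟨e1, e2⟩ := eq_of_sq_eq_zero hi
    simp only at e1 e2
    subst e1 e2
    have ht : s ≤ |t - q₀.2.2| := le_of_not_gt fun h => hq (hmem i t h)
    have hT : 8 * a ^ 2 < |t - (shift q₀ j₀ (α i) (β i)).2.2| := by
      have e : t - q₀.2.2 = (t - (shift q₀ j₀ (α i) (β i)).2.2)
          + (-2 * β i * A + 2 * α i * B) := by simp only [shift]; ring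
      have h1 := abs_add_le (t - (shift q₀ j₀ (α i) (β i)).2.2) (-2 * β i * A + 2 * α i * B)
      rw [← e] at h1
      nlinarith [hshift i]
    simp only [gauge4_shift]
    set T := t - (shift q₀ j₀ (α i) (β i)).2.2
    have ha4 : 0 < a ^ 2 := by positivity
    rcases le_total 0 T with h0 | h0
    · rw [abs_of_nonneg h0] at hT
      refine ⟨i + 1, ?_⟩
      fin_cases i <;> simp [α, β] <;>
        nlinarith [mul_pos ha4 (sub_pos.2 hT), pow_pos ha0 4]
    · rw [abs_of_nonpos h0] at hT
      refine ⟨i + 2, ?_⟩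
      fin_cases i <;> simp [α, β] <;>
        nlinarith [mul_pos ha4 (sub_pos.2 hT), pow_pos ha0 4]

theorem IsWeakSolution.eq_of_bounded (hm : 1 ≤ m) {φ f l : ℝ → ℝ} (hφ : CondPhi φ)
    (hf : CondF f) (hl : CondL l) (hφl : Tendsto (fun t => φ t / l t) (𝓝[>] 0) (𝓝 0))
    {u : Heis m → ℝ} (hu0 : ∀ q, 0 ≤ u q) {M : ℝ} (hM : ∀ q, u q ≤ M)
    (hu : IsWeakSolution φ f l u) (q₁ q₀ : Heis m) : u q₁ ≤ u q₀ := by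
  by_contra! hlt
  set c := (u q₀ + u q₁) / 2 with hc
  have hc0 : u q₀ < c := by linarith
  have hc1 : c < u q₁ := by linarith
  have hcpos : 0 < c := (hu0 q₀).trans_lt hc0
  have hucont := hu.1.continuous
  set O : Set (Heis m) := {q | u q < c}
  have hOo : IsOpen O := isOpen_lt hucont continuous_const
  obtain ⟨h, hhO, hst⟩ := exists_staircase hm (hOo.mem_nhds hc0)
  have hq₁ : q₁ ∈ Oᶜ := fun h => lt_asymm hc1 h
  have hr : ∀ i, ∃ r > 0, ∀ q ∈ Oᶜ, r ≤ gauge (h i) q := fun i => by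
    obtain ⟨p, hp, hpm⟩ := (continuous_gauge (h i)).continuousOn.exists_isMinOn'
      hOo.isClosed_compl hq₁
      (((tendsto_gauge (h i)).eventually_ge_atTop _).filter_mono inf_le_left)
    exact ⟨_, gauge_pos (gauge4_pos fun e : p = h i => hp (by rw [e]; exact hhO i)), fun q hq => hpm hq⟩
  choose ρ hρ0 hρ using hr
  obtain ⟨i₀, hi₀⟩ := Finite.exists_min ρ
  set r := ρ i₀
  have hr0 : 0 < r := hρ0 i₀
  have hfc := hf.pos c hcpos
  -- This is the value that `φ/l` would have to reach at a touching point.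
  have hη : 0 < f c * r / (2 * m + 1) := by positivity
  obtain ⟨p₀, hp₀, hsmall⟩ := mem_nhdsGT_iff_exists_Ioo_subset.1 (hφl.eventually_lt_const hη)
  have hp₀' : 0 < p₀ := hp₀
  have key : ∀ ε ∈ Ioo 0 p₀, u q₁ ≤ c + ε * gauge (h 0) q₁ := by
    rintro ε ⟨hε, hεp⟩
    by_contra! hcon
    have hex : ∀ i, ∃ x, ∀ q, u q - ε * gauge (h i) q ≤ u x - ε * gauge (h i) x := fun i => by
      refine (hucont.sub ((continuous_gauge (h i)).const_mul ε)).exists_forall_ge' q₁ ?_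
      filter_upwards [(tendsto_gauge (h i)).eventually_ge_atTop
        ((M - (u q₁ - ε * gauge (h i) q₁)) / ε)] with q hq
      rw [div_le_iff₀ hε] at hq
      change u q - ε * gauge (h i) q ≤ u q₁ - ε * gauge (h i) q₁
      linarith [hM q]
    choose x hx using hex
    -- Taking the centre with the largest maximum excludes the axis: a strictly closer centre would
    -- give a larger value at the same point.
    obtain ⟨i, hi⟩ := Finite.exists_max fun i => u (x i) - ε * gauge (h i) (x i)
    have hmaxc : c < u (x i) - ε * gauge (h i) (x i) := by linarith [hi 0, hx 0 q₁]
    have hcu : c < u (x i) := by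
      have := mul_nonneg hε.le (gauge_nonneg (h i) (x i)); linarith
    have hxO : x i ∉ O := fun h => lt_asymm hcu h
    have hsq : 0 < sq (h i) (x i) := by
      refine (sqDist_nonneg _ _).lt_of_ne' fun h0 => ?_
      obtain ⟨j, hj⟩ := hst _ hxO i h0
      have h1 : gauge (h j) (x i) < gauge (h i) (x i) :=
        Real.rpow_lt_rpow (gauge4_nonneg _ _) hj (by norm_num)
      have h2 := mul_lt_mul_of_pos_left h1 hε
      linarith [hi j, hx j (x i)]
    have h4 : 0 < gauge4 (h i) (x i) := by unfold gauge4; positivity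
    have hg := gauge_pos h4
    set p := ‖hgrad (fun q => ε * gauge (h i) q) (x i)‖ with hp
    have hpe : p = ε * √(sq (h i) (x i) / gauge (h i) (x i) ^ 2) := norm_hgrad_gauge h4 hε.le
    have hp0 : 0 < p := by rw [hpe]; positivity
    have hpε : p ≤ ε := by
      rw [hpe]
      refine mul_le_of_le_one_right hε.le (Real.sqrt_le_one.2 ?_)
      exact div_le_one_of_le₀ (sq_le_gauge_sq _ _) (by positivity)
    have ht := touching hφ hf.continuousOn hl.continuousOn hu0 hu
      (w := fun q => ε * gauge (h i) q) (q₀ := x i)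
      (contDiffAt_const.mul (contDiffAt_gauge h4)) (norm_pos_iff.1 hp0)
      (Eventually.of_forall fun q => hx i q)
    rw [hdiv_radialFlux_gauge hφ hsq hε, ← hp] at ht
    have hlp := hl.pos p hp0
    have hφp := hφ.pos hp0
    have hq : φ p / l p < f c * r / (2 * m + 1) := hsmall ⟨hp0, hpε.trans_lt hεp⟩
    rw [div_lt_div_iff₀ hlp (by positivity)] at hq
    have hfu : f c ≤ f (u (x i)) := hf.monotoneOn hcpos.le (hu0 _) hcu.le
    have h5 : (2 * m + 1) * √(sq (h i) (x i)) / gauge (h i) (x i) ^ 2 ≤ (2 * m + 1) / r := by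
      have a1 : √(sq (h i) (x i)) ≤ gauge (h i) (x i) :=
        Real.sqrt_le_iff.2 ⟨hg.le, sq_le_gauge_sq _ _⟩
      have a2 : r ≤ gauge (h i) (x i) := (hi₀ i).trans (hρ i _ hxO)
      calc (2 * m + 1) * √(sq (h i) (x i)) / gauge (h i) (x i) ^ 2
          ≤ (2 * m + 1) * gauge (h i) (x i) / gauge (h i) (x i) ^ 2 := by gcongr
        _ = (2 * m + 1) / gauge (h i) (x i) := by field_simp
        _ ≤ (2 * m + 1) / r := by gcongr
    have h6 : f c * l p ≤ φ p * ((2 * m + 1) / r) :=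
      (mul_le_mul_of_nonneg_right hfu hlp.le).trans
        (ht.trans (mul_le_mul_of_nonneg_left h5 hφp.le))
    rw [← mul_div_assoc, le_div_iff₀ hr0] at h6
    linarith
  have hlim : Tendsto (fun ε : ℝ => c + ε * gauge (h 0) q₁) (𝓝[>] 0) (𝓝 c) := by
    have : Tendsto (fun ε : ℝ => c + ε * gauge (h 0) q₁) (𝓝 0) (𝓝 (c + 0 * gauge (h 0) q₁)) :=
      (tendsto_id.mul_const _).const_add c
    rw [zero_mul, add_zero] at this
    exact this.mono_left nhdsWithin_le_nhds
  have : u q₁ ≤ c := ge_of_tendsto hlim (by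
    filter_upwards [Ioo_mem_nhdsGT hp₀'] with ε hε using key ε hε)
  linarith

/-- Tested with a bump function, the left side vanishes, while the right side is `f(c) l(0)` times a
positive integral if `c > 0`. -/
theorem IsWeakSolution.const_eq_zero {φ f l : ℝ → ℝ} (hf : CondF f) (hl0 : 0 < l 0)
    {c : ℝ} (hc : 0 ≤ c) (hu : IsWeakSolution φ f l (fun _ : Heis m => c)) : c = 0 := by
  by_contra hne
  have hfc := hf.pos c (hc.lt_of_ne' hne)
  let b : ContDiffBump (0 : Heis m) := ⟨1, 2, one_pos, one_lt_two⟩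
  have hh := hu.2 b b.contDiff b.hasCompactSupport fun q => b.nonneg
  have hg : ∀ q : Heis m, gradNorm (fun _ : Heis m => c) q = 0 := fun q => by
    simp [gradNorm, gradDot, X, Y]
  simp only [hg, inv_zero, zero_mul, integral_zero, neg_zero, integral_const_mul] at hh
  have := mul_pos (mul_pos hfc hl0) (b.integral_pos (μ := volume))
  linarith

end Heis

theorem mainTheorem3 (m : ℕ) (hm : 1 ≤ m) (φ f l : ℝ → ℝ) (D Λ τ : ℝ)
    (hD : 0 < D) (hΛ : 0 < Λ) (hτ : 0 ≤ τ)
    (hφ : CondPhi φ) (hf : CondF f) (hl : CondL l) (hφl : CondPhiL φ l)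
    (hφ2 : CondPhi2 φ D τ) (hl2 : CondL2 l Λ τ)
    (u : Heis m → ℝ) (hu_nonneg : ∀ q, 0 ≤ u q) (hu_bdd : ∃ M : ℝ, ∀ q, u q ≤ M)
    (hu : Heis.IsWeakSolution φ f l u) :
    (∃ c : ℝ, ∀ q, u q = c) ∧ (0 < l 0 → ∀ q, u q = 0) := by
  obtain ⟨M, hM⟩ := hu_bdd
  have hconst : ∀ q, u q = u 0 := fun q =>
    le_antisymm (hu.eq_of_bounded hm hφ hf hl hφl.tendsto_zero hu_nonneg hM q 0)
      (hu.eq_of_bounded hm hφ hf hl hφl.tendsto_zero hu_nonneg hM 0 q)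
  refine ⟨⟨u 0, hconst⟩, fun hl0 q => ?_⟩
  rw [hconst q]
  rw [show u = fun _ => u 0 from funext hconst] at hu
  exact hu.const_eq_zero hf hl0 (hu_nonneg 0)
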